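/- **Setting.** For a matrix $B\in\mathbb R^{p\times m}$ let $\|B\|_F$ be the Frobenius norm, $\|B\|_{2,\infty}$ the largest Euclidean norm of a row, and $\|B\|_{2,\mathcal C}$ the number of distinct rows of $B$. Let $\langle\cdot,\cdot\rangle$ be the Frobenius inner product and $a\wedge b=\min(a,b)$. Let $X\in\mathbb R^{n\times p}$ and $B^*\in\mathbb R^{p\times m}$ be fixed, let $Y$ be random data, and let $l_0(\eta;Y)$ be a loss, measurable in $Y$, which for every value of $Y$ is differentiable and $\mu$-strongly convex in $\eta\in\mathbb R^{n\times m}$, $\mu>0$: $$l_0(\eta';Y)\ge l_0(\eta;Y)+\langle\nabla l_0(\eta;Y),\eta'-\eta\rangle+\tfrac{\mu}{2}\|\eta'-\eta\|_F^2\qquad\text{for all }\eta,\eta'.$$ Put $\mathbf D_{l_0}(\alpha,\beta)=l_0(\alpha;Y)-l_0(\beta;Y)-\langle\nabla l_0(\beta;Y),\alpha-\beta\rangle$. Assume that the effective noise $E=-\nabla l_0(XB^*;Y)$ is sub-Gaussian with mean zero and scale bounded by $\sigma\ge0$, that is, $\mathbb E E=0$ and $\|\langle E,A\rangle\|_{\psi_2}\le\sigma\|A\|_F$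 for all $A\in\mathbb R^{n\times m}$, where $\|Z\|_{\psi_2}=\inf\{t>0:\mathbb E\exp(Z^2/t^2)\le2\}$. Let $1\le q\le p$ and $r\ge0$ be integers, and let $\hat B$ (a random matrix) be a global minimizer of $B\mapsto l_0(XB;Y)$ over all $B\in\mathbb R^{p\times m}$ with $\operatorname{rank}(B)\le r$ and $\|B\|_{2,\mathcal C}\le q$. **Corollary 1.** There are universal constants $C_1,c_0,c,C>0$ such that the following holds in every such setting. (i) For every $B\in\mathbb R^{p\times m}$ with $\operatorname{rank}(B)\le r$ and $\|B\|_{2,\mathcal C}\le q$, $$\mathbb E\,\mathbf D_{l_0}(X\hat B,XB^*)\le C_1\Big[\mathbb E\,\mathbf D_{l_0}(XB,XB^*)+\frac{\sigma^2}{\mu}\big\{(q\wedge\operatorname{rank}X+m)\,r+(p-q)\log q+1\big\}\Big].$$ (ii) Let $r^*=\operatorname{rank}(B^*)$ and $q^*=\|B^*\|_{2,\mathcal C}$. Suppose that $q^*>1$, that $r=\vartheta r^*$ and $q=\vartheta q^*$ for some real $\vartheta\ge1$, and that for some $\delta>0$ $$\frac1n\|XB\|_F^2\ge\delta\,\|B\|_{2,\infty}^2\qquad\text{for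 all }B\in\mathbb R^{p\times m}\text{ with }\operatorname{rank}(B)\le(1+\vartheta)r^*,\ \|B\|_{2,\mathcal C}\le\vartheta q^{*2}.$$ Then with probability at least $1-C\exp\{-c(m+\operatorname{rank}X)\}$ $$\|\hat B-B^*\|_{2,\infty}^2\le R:=\frac{c_0\vartheta^2\sigma^2}{n\delta\mu^2}\big\{(q^*\wedge\operatorname{rank}X+m)\,r^*+(p-q^*)\log q^*\big\}.$$ (iii) If, in addition to the assumptions of (ii), any two distinct rows $b^*_j\ne b^*_k$ of $B^*$ satisfy $\|b_j^*-b_k^*\|_2^2>4R$, then with probability at least $1-C\exp\{-c(m+\operatorname{rank}X)\}$ the row clusters of $\hat B$ refine those of $B^*$ (equal rows $\hat b_j=\hat b_k$ of $\hat B$ have $b^*_j=b^*_k$), and they coincide with those of $B^*$ if $q=q^*$. -/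

import Mathlib

open MeasureTheory
open scoped ENNReal

noncomputable section

namespace CRL

/-- Frobenius inner product `⟨A, B⟩`. -/
def frobInner {n m : ℕ} (A B : Matrix (Fin n) (Fin m) ℝ) : ℝ :=
  ∑ i, ∑ j, A i j * B i j

/-- Squared Frobenius norm `‖A‖_F²`. -/
def frobSq {n m : ℕ} (A : Matrix (Fin n) (Fin m) ℝ) : ℝ :=
  ∑ i, ∑ j, A i j ^ 2

/-- `‖A‖_{2,∞}`: the largest Euclidean norm of a row of `A`. -/
def twoInfNorm {p m : ℕ} (A : Matrix (Fin p) (Fin m) ℝ) : ℝ :=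
  ⨆ j : Fin p, Real.sqrt (∑ l, A j l ^ 2)

/-- `‖B‖_{2,𝒞}`: the number of distinct rows of `B`. -/
def numRows {p m : ℕ} (B : Matrix (Fin p) (Fin m) ℝ) : ℕ :=
  (Set.range fun j : Fin p => B j).ncard

/-- The matrices of rank at most `r` with at most `q` distinct rows. -/
def feasible (p m q r : ℕ) : Set (Matrix (Fin p) (Fin m) ℝ) :=
  {B | B.rank ≤ r ∧ numRows B ≤ q}

/-- The gradient of `f` at `η`, as the matrix of partial derivatives. -/
def grad {n m : ℕ} (f : Matrix (Fin n) (Fin m) ℝ → ℝ) (η : Matrix (Fin n) (Fin m) ℝ) :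
    Matrix (Fin n) (Fin m) ℝ :=
  Matrix.of fun i j => fderiv ℝ f η (Matrix.single i j 1)

/-- The Bregman function `f(α) - f(β) - ⟨∇f(β), α - β⟩`. -/
def bregman {n m : ℕ} (f : Matrix (Fin n) (Fin m) ℝ → ℝ) (α β : Matrix (Fin n) (Fin m) ℝ) : ℝ :=
  f α - f β - frobInner (grad f β) (α - β)

/-- `f` is differentiable and `μ`-strongly convex. -/
def StronglyConvex {n m : ℕ} (μ : ℝ) (f : Matrix (Fin n) (Fin m) ℝ → ℝ) : Prop :=
  Differentiable ℝ f ∧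
    ∀ η η' : Matrix (Fin n) (Fin m) ℝ,
      f η + frobInner (grad f η) (η' - η) + μ * frobSq (η' - η) / 2 ≤ f η'

/-- The norm `‖Z‖_{ψ₂} = inf {t > 0 : 𝔼 exp((Z/t)²) ≤ 2}`, with value `∞` if there is
no such `t`. -/
def psi2Norm {Ω : Type*} [MeasurableSpace Ω] (P : Measure Ω) (Z : Ω → ℝ) : ℝ≥0∞ :=
  ⨅ (t : ℝ) (_ : 0 < t) (_ : ∫⁻ ω, ENNReal.ofReal (Real.exp ((Z ω / t) ^ 2)) ∂P ≤ 2),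
    ENNReal.ofReal t

/-- `vec(E)` is a sub-Gaussian random vector with mean zero and scale bounded by `σ`. -/
def SubGaussianMatrix {Ω : Type*} [MeasurableSpace Ω] {n m : ℕ} (P : Measure Ω)
    (E : Ω → Matrix (Fin n) (Fin m) ℝ) (σ : ℝ) : Prop :=
  (∀ i j, AEMeasurable (fun ω => E ω i j) P) ∧
  (∀ i j, ∫ ω, E ω i j ∂P = 0) ∧
  ∀ A : Matrix (Fin n) (Fin m) ℝ,
    psi2Norm P (fun ω => frobInner (E ω) A) ≤ ENNReal.ofReal (σ * Real.sqrt (frobSq A))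

/-- The complexity `(q ∧ rank X + m) r + (p - q) log q`. -/
def complexity {n p : ℕ} (m : ℕ) (X : Matrix (Fin n) (Fin p) ℝ) (q r : ℕ) : ℝ :=
  (((min q X.rank : ℕ) : ℝ) + m) * r + ((p : ℝ) - q) * Real.log q

/-- `B` is a global minimizer of `B ↦ f(X B)` over the matrices of rank at most `r` with at most
`q` distinct rows. -/
def IsGlobalCRL {n p m : ℕ} (X : Matrix (Fin n) (Fin p) ℝ) (f : Matrix (Fin n) (Fin m) ℝ → ℝ)
    (q r : ℕ) (B : Matrix (Fin p) (Fin m) ℝ) : Prop :=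
  B ∈ feasible p m q r ∧ IsMinOn (fun B' => f (X * B')) (feasible p m q r) B

/-- The right-hand side `c₀ ϑ² σ² / (n δ μ²) · {(q* ∧ rank X + m) r* + (p - q*) log q*}`,
with `r* = rank B*` and `q* = ‖B*‖_{2,𝒞}`. -/
def estBound {n p m : ℕ} (X : Matrix (Fin n) (Fin p) ℝ) (Bstar : Matrix (Fin p) (Fin m) ℝ)
    (c₀ ϑ σ δ μ : ℝ) : ℝ :=
  c₀ * ϑ ^ 2 * σ ^ 2 / (n * δ * μ ^ 2) * complexity m X (numRows Bstar) Bstar.rank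

end CRL

end

universe u v

open CRL

/-!
Comparing a minimizer `M` with a feasible `B` gives the basic inequality
`D(XM, XB*) ≤ D(XB, XB*) + ⟨E, XM - XB⟩`, and strong convexity absorbs the Frobenius norm of
`XM - XB` once the noise term is written as that norm times a linear functional of a unit matrix.

To control the functional, choose a map `F` on row indices with at most `q` values such that row `j`
of `M` is row `F j` of `M` for every `j`: a family of at most `q ^ (2 (p - q))` maps suffices for
all `M`. Given `F`, the matrix `XM - XB` lies in a fixed space of matrices whose columns span
dimension at most `2 (q ∧ rank X)`. A matrix of rank at most `2 r` in that space factors as an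
orthonormal frame times coefficients, and half-nets of the two factors bound the functional by four
times its maximum over a finite set of unit matrices. The logarithm of the cardinality is at most
`8` times the complexity, so the `ψ₂` bound controls the maximum both in mean and in probability.
The restricted eigenvalue condition turns the prediction error into a row-wise error, and separated
rows of `B*` then cannot share a row of `M`.
-/

namespace CRL

open Metric Filter Topology
open scoped NNReal

section HalfNet

variable {V W : Type*} [NormedAddCommGroup V] [NormedSpace ℝ V] [FiniteDimensional ℝ V]
  [NormedAddCommGroup W] [NormedSpace ℝ W] [FiniteDimensional ℝ W]

lemma card_le_of_isSeparated_half {s : Finset V} (hball : (s : Set V) ⊆ closedBall 0 1)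
    (hsep : IsSeparated (1 / 2 : ℝ≥0) (s : Set V)) : s.card ≤ 5 ^ Module.finrank ℝ V := by
  classical
  rw [← Finset.card_image_of_injective s (smul_right_injective V (two_ne_zero : (2 : ℝ) ≠ 0))]
  refine Besicovitch.card_le_of_separated _ (fun c hc => ?_) fun c hc d hd hcd => ?_
  · obtain ⟨x, hx, rfl⟩ := Finset.mem_image.1 hc
    have hx1 : ‖x‖ ≤ 1 := by simpa using hball hx
    rw [norm_smul, Real.norm_ofNat]
    linarith
  · obtain ⟨x, hx, rfl⟩ := Finset.mem_image.1 hc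
    obtain ⟨y, hy, rfl⟩ := Finset.mem_image.1 hd
    have hdist : 1 / 2 < ‖x - y‖ := by
      have h : _ < edist x y := hsep hx hy (ne_of_apply_ne _ hcd)
      rw [edist_nndist, ENNReal.coe_lt_coe, ← NNReal.coe_lt_coe, coe_nndist, dist_eq_norm] at h
      simpa using h
    rw [← smul_sub, norm_smul, Real.norm_ofNat]
    linarith

lemma packingNumber_half_closedBall_le (V : Type*) [NormedAddCommGroup V] [NormedSpace ℝ V]
    [FiniteDimensional ℝ V] :
    packingNumber (1 / 2) (closedBall (0 : V) 1) ≤ 5 ^ Module.finrank ℝ V := by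
  refine iSup₂_le fun C hC => iSup_le fun hsep => ?_
  by_contra! hcard
  obtain ⟨D, hDC, hD⟩ := Set.exists_subset_encard_eq (Order.add_one_le_of_lt hcard)
  have hDfin : D.Finite := Set.finite_of_encard_eq_coe (k := 5 ^ Module.finrank ℝ V + 1)
    (by exact_mod_cast hD)
  lift D to Finset V using hDfin
  have hle := card_le_of_isSeparated_half (hDC.trans hC) (hsep.subset hDC)
  rw [Set.encard_coe_eq_coe_finsetCard] at hD
  norm_cast at hD
  omega

lemma exists_finset_isCover_half_closedBall (V : Type*) [NormedAddCommGroup V] [NormedSpace ℝ V]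
    [FiniteDimensional ℝ V] :
    ∃ s : Finset V, s.card ≤ 5 ^ Module.finrank ℝ V ∧ (s : Set V) ⊆ closedBall 0 1 ∧
      IsCover (1 / 2) (closedBall (0 : V) 1) (s : Set V) := by
  have hle := packingNumber_half_closedBall_le V
  have htop : packingNumber (1 / 2) (closedBall (0 : V) 1) ≠ ⊤ :=
    ne_top_of_le_ne_top (by exact_mod_cast ENat.natCast_ne_top _) hle
  have hcard := (encard_maximalSeparatedSet htop).trans_le hle
  have hfin : (maximalSeparatedSet (1 / 2) (closedBall (0 : V) 1)).Finite :=
    Set.finite_of_encard_le_coe (k := 5 ^ Module.finrank ℝ V) (by exact_mod_cast hcard)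
  have hcover := isCover_maximalSeparatedSet htop
  have hsub := maximalSeparatedSet_subset (ε := 1 / 2) (A := closedBall (0 : V) 1)
  generalize maximalSeparatedSet (1 / 2) (closedBall (0 : V) 1) = N at *
  lift N to Finset V using hfin
  rw [Set.encard_coe_eq_coe_finsetCard] at hcard
  exact ⟨N, by exact_mod_cast hcard, hsub, hcover⟩

-- With `x₀` maximizing `φ` on the ball and `y` a net point, `2 • (x₀ - y)` is again in the ball,
-- so that `2 * (φ x₀ - φ y) ≤ φ x₀`.
lemma exists_le_two_mul_of_isCover {s : Set V} (hs : IsCover (1 / 2) (closedBall 0 1) s)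
    (φ : V →ₗ[ℝ] ℝ) {x : V} (hx : x ∈ closedBall 0 1) : ∃ y ∈ s, φ x ≤ 2 * φ y := by
  obtain ⟨x₀, hx₀, hmax⟩ := (isCompact_closedBall (0 : V) 1).exists_isMaxOn ⟨x, hx⟩
    φ.continuous_of_finiteDimensional.continuousOn
  obtain ⟨y, hy, hdist⟩ : ∃ y ∈ s, dist x₀ y ≤ 1 / 2 := by
    simpa using isCover_iff_subset_iUnion_closedBall.1 hs hx₀
  have hball : (2 : ℝ) • (x₀ - y) ∈ closedBall 0 1 := by
    rw [dist_eq_norm] at hdist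
    rw [mem_closedBall_zero_iff, norm_smul, Real.norm_ofNat]
    linarith
  have hφ : φ ((2 : ℝ) • (x₀ - y)) ≤ φ x₀ := hmax hball
  have hφx : φ x ≤ φ x₀ := hmax hx
  rw [map_smul, map_sub, smul_eq_mul] at hφ
  exact ⟨y, hy, by linarith⟩

lemma exists_le_four_mul_of_isCover {s : Set V} {t : Set W}
    (hs : IsCover (1 / 2) (closedBall 0 1) s) (ht : IsCover (1 / 2) (closedBall 0 1) t)
    (φ : V →ₗ[ℝ] W →ₗ[ℝ] ℝ) {x : V} {y : W} (hx : x ∈ closedBall 0 1) (hy : y ∈ closedBall 0 1) :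
    ∃ x' ∈ s, ∃ y' ∈ t, φ x y ≤ 4 * φ x' y' := by
  obtain ⟨x', hx', hle⟩ := exists_le_two_mul_of_isCover hs (φ.flip y) hx
  obtain ⟨y', hy', hle'⟩ := exists_le_two_mul_of_isCover ht (φ x') hy
  rw [LinearMap.flip_apply, LinearMap.flip_apply] at hle
  exact ⟨x', hx', y', hy', by linarith⟩

end HalfNet

section Factorization

lemma exists_linearIsometry_euclideanSpace {V : Type*} [NormedAddCommGroup V]
    [InnerProductSpace ℝ V] [FiniteDimensional ℝ V] {k : ℕ} (h : Module.finrank ℝ V ≤ k) :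
    Nonempty (V →ₗᵢ[ℝ] EuclideanSpace ℝ (Fin k)) := by
  let b := stdOrthonormalBasis ℝ V
  let e := EuclideanSpace.basisFun (Fin k) ℝ
  refine ⟨(b.toBasis.constr ℝ (e ∘ Fin.castLE h)).isometryOfOrthonormal (v := b.toBasis)
    (by simp) ?_⟩
  have hcomp : b.toBasis.constr ℝ (e ∘ Fin.castLE h) ∘ b.toBasis = e ∘ Fin.castLE h := by
    funext i
    simp only [Function.comp_apply, Module.Basis.constr_basis]
  rw [hcomp]
  exact e.orthonormal.comp _ (Fin.castLE_injective h)

variable {ι W : Type*} [NormedAddCommGroup W] [InnerProductSpace ℝ W] [FiniteDimensional ℝ W]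
  {k : ℕ}

lemma exists_factorization_of_finrank_span_le (v : ι → W)
    (hv : Module.finrank ℝ (Submodule.span ℝ (Set.range v)) ≤ k) :
    ∃ (G : EuclideanSpace ℝ (Fin k) →L[ℝ] W) (H : ι → EuclideanSpace ℝ (Fin k)),
      ‖G‖ ≤ 1 ∧ (∀ l, G (H l) = v l) ∧ ∀ l, ‖H l‖ = ‖v l‖ := by
  obtain ⟨e⟩ := exists_linearIsometry_euclideanSpace hv
  let v' : ι → Submodule.span ℝ (Set.range v) := fun l => ⟨v l, Submodule.subset_span ⟨l, rfl⟩⟩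
  let G := (Submodule.span ℝ (Set.range v)).subtypeL ∘L e.toContinuousLinearMap.adjoint
  have hG : ‖G‖ ≤ 1 := calc
    ‖G‖ ≤ ‖(Submodule.span ℝ (Set.range v)).subtypeL‖ * ‖e.toContinuousLinearMap.adjoint‖ :=
      ContinuousLinearMap.opNorm_comp_le _ _
    _ ≤ 1 * 1 := by
      gcongr
      · exact Submodule.norm_subtypeL_le _
      · rw [LinearIsometryEquiv.norm_map]
        exact e.norm_toContinuousLinearMap_le
    _ = 1 := one_mul 1
  have hadj : ∀ w, e.toContinuousLinearMap.adjoint (e w) = w := fun w =>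
    ext_inner_right ℝ fun u => by
      rw [ContinuousLinearMap.adjoint_inner_left]
      exact e.inner_map_map w u
  exact ⟨G, fun l => e (v' l), hG, fun l => congrArg Subtype.val (hadj (v' l)),
    fun l => e.norm_map (v' l)⟩

/-- Entrywise application `(G, H) ↦ (G (H l))_l`, the bilinear map that writes a family spanning
at most `k` dimensions as a product of two factors through `ℝᵏ`. -/
def factorMap (ι W : Type*) [Fintype ι] [NormedAddCommGroup W] [InnerProductSpace ℝ W] (k : ℕ) :
    (EuclideanSpace ℝ (Fin k) →L[ℝ] W) →ₗ[ℝ] (PiLp 2 fun _ : ι => EuclideanSpace ℝ (Fin k)) →ₗ[ℝ]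
      PiLp 2 fun _ : ι => W :=
  LinearMap.mk₂ ℝ (fun G H => WithLp.toLp 2 fun l => G (H l))
    (fun _ _ _ => rfl) (fun _ _ _ => rfl)
    (fun G H H' => PiLp.ext fun l => G.map_add (H l) (H' l))
    (fun c G H => PiLp.ext fun l => G.map_smul c (H l))

omit [FiniteDimensional ℝ W] in
lemma norm_factorMap_le [Fintype ι] (G : EuclideanSpace ℝ (Fin k) →L[ℝ] W)
    (H : PiLp 2 fun _ : ι => EuclideanSpace ℝ (Fin k)) : ‖factorMap ι W k G H‖ ≤ ‖G‖ * ‖H‖ := by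
  refine le_of_sq_le_sq ?_ (by positivity)
  rw [mul_pow, PiLp.norm_sq_eq_of_L2, PiLp.norm_sq_eq_of_L2, Finset.mul_sum]
  refine Finset.sum_le_sum fun l _ => ?_
  rw [← mul_pow]
  gcongr
  exact G.le_opNorm (H l)

lemma finrank_continuousLinearMap_euclideanSpace :
    Module.finrank ℝ (EuclideanSpace ℝ (Fin k) →L[ℝ] W) = k * Module.finrank ℝ W := by
  rw [← LinearMap.toContinuousLinearMap.finrank_eq, Module.finrank_linearMap,
    finrank_euclideanSpace_fin]

lemma finrank_piLp_euclideanSpace [Fintype ι] :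
    Module.finrank ℝ (PiLp 2 fun _ : ι => EuclideanSpace ℝ (Fin k)) = k * Fintype.card ι := by
  rw [(WithLp.linearEquiv 2 ℝ (ι → EuclideanSpace ℝ (Fin k))).finrank_eq,
    Module.finrank_pi_fintype]
  simp only [finrank_euclideanSpace_fin, Finset.sum_const, Finset.card_univ, smul_eq_mul, mul_comm]

variable (ι W k) in
lemma exists_lowRank_net [Fintype ι] :
    ∃ s : Finset (PiLp 2 fun _ : ι => W),
      s.card ≤ 5 ^ (k * (Module.finrank ℝ W + Fintype.card ι)) ∧
      (s : Set (PiLp 2 fun _ : ι => W)) ⊆ closedBall 0 1 ∧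
      ∀ v, Module.finrank ℝ (Submodule.span ℝ (Set.range v.ofLp)) ≤ k →
        ∀ φ : (PiLp 2 fun _ : ι => W) →ₗ[ℝ] ℝ, ∃ y ∈ s, φ v ≤ 4 * ‖v‖ * φ y := by
  classical
  obtain ⟨s, hs, hs1, hscover⟩ :=
    exists_finset_isCover_half_closedBall (EuclideanSpace ℝ (Fin k) →L[ℝ] W)
  obtain ⟨t, ht, ht1, htcover⟩ :=
    exists_finset_isCover_half_closedBall (PiLp 2 fun _ : ι => EuclideanSpace ℝ (Fin k))
  refine ⟨(s ×ˢ t).image fun x => factorMap ι W k x.1 x.2, ?_, ?_, fun v hv φ => ?_⟩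
  · calc _ ≤ s.card * t.card := Finset.card_image_le.trans_eq (Finset.card_product s t)
      _ ≤ 5 ^ (k * Module.finrank ℝ W) * 5 ^ (k * Fintype.card ι) := by
        rw [finrank_continuousLinearMap_euclideanSpace] at hs
        rw [finrank_piLp_euclideanSpace] at ht
        gcongr
      _ = _ := by rw [← pow_add, ← mul_add]
  · intro y hy
    obtain ⟨⟨G, H⟩, hGH, rfl⟩ := Finset.mem_image.1 (Finset.mem_coe.1 hy)
    have hG := mem_closedBall_zero_iff.1 (hs1 (Finset.mem_product.1 hGH).1)
    have hH := mem_closedBall_zero_iff.1 (ht1 (Finset.mem_product.1 hGH).2)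
    exact mem_closedBall_zero_iff.2
      ((norm_factorMap_le G H).trans (mul_le_one₀ hG (norm_nonneg H) hH))
  · obtain ⟨G, h, hG, hGh, hh⟩ := exists_factorization_of_finrank_span_le v.ofLp hv
    let H : PiLp 2 fun _ : ι => EuclideanSpace ℝ (Fin k) := WithLp.toLp 2 h
    have hH : ‖H‖ = ‖v‖ := by
      simp only [PiLp.norm_eq_of_L2, H, hh]
    have hv : factorMap ι W k G H = v := PiLp.ext hGh
    obtain ⟨G', hG', H', hH', hle⟩ := exists_le_four_mul_of_isCover hscover htcover
      ((factorMap ι W k).compr₂ φ) (mem_closedBall_zero_iff.2 hG)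
      (y := ‖v‖⁻¹ • H) (by
        rw [mem_closedBall_zero_iff, norm_smul, norm_inv, norm_norm, hH]
        exact inv_mul_le_one)
    refine ⟨_, Finset.mem_image_of_mem _ (Finset.mk_mem_product hG' hH'), ?_⟩
    rw [map_smul, LinearMap.compr₂_apply, hv, smul_eq_mul] at hle
    rcases eq_or_ne v 0 with rfl | hv0
    · simp
    · rw [inv_mul_le_iff₀ (norm_pos_iff.2 hv0)] at hle
      exact hle.trans_eq (by rw [LinearMap.compr₂_apply]; ring)

end Factorization

section ClusterMaps

variable {ι : Type*} [Fintype ι] [DecidableEq ι]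

/-- The maps `ι → ι` with values in `S` that fix every point of `S`. -/
def retractions (S : Finset ι) : Finset (ι → ι) :=
  Fintype.piFinset fun x => if x ∈ S then {x} else S

lemma card_retractions (S : Finset ι) :
    (retractions S).card = S.card ^ (Fintype.card ι - S.card) := by
  simp only [retractions, Fintype.card_piFinset, apply_ite Finset.card, Finset.card_singleton,
    Finset.prod_ite, Finset.prod_const_one, one_mul, Finset.prod_const]
  rw [← Finset.card_compl, Finset.compl_eq_univ_sdiff, Finset.filter_notMem_eq_sdiff]

lemma range_subset_of_mem_retractions {S : Finset ι} {F : ι → ι} (hF : F ∈ retractions S) :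
    Set.range F ⊆ S := by
  rintro _ ⟨x, rfl⟩
  have hx := Fintype.mem_piFinset.1 hF x
  split_ifs at hx with hxS
  · rwa [Finset.mem_singleton.1 hx]
  · exact hx

lemma exists_mem_retractions_comp_eq {α : Type*} {S : Finset ι} {b : ι → α}
    (hS : ∀ j, ∃ k ∈ S, b k = b j) : ∃ F ∈ retractions S, b ∘ F = b := by
  choose rep hrep hb using hS
  refine ⟨fun j => if j ∈ S then j else rep j, Fintype.mem_piFinset.2 fun j => ?_, ?_⟩
  · split_ifs
    exacts [Finset.mem_singleton_self j, hrep j]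
  · funext j
    dsimp only [Function.comp_apply]
    split_ifs
    exacts [rfl, hb j]

omit [DecidableEq ι] in
lemma exists_transversal {α : Type*} (b : ι → α) (j₀ : ι) {q : ℕ} (hb : (Set.range b).ncard ≤ q)
    (hq : q ≤ Fintype.card ι) : ∃ S : Finset ι, S.card = q ∧ j₀ ∈ S ∧ ∀ j, ∃ k ∈ S, b k = b j := by
  obtain ⟨s, hj₀, hs⟩ := (Set.bijOn_singleton.2 rfl : Set.BijOn b {j₀} {b j₀}).exists_extend
    (Set.singleton_subset_iff.2 (Set.mem_range_self j₀)) subset_rfl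
  lift s to Finset ι using s.toFinite
  have hcard : s.card ≤ q := by
    rw [← Set.ncard_coe_finset, ← hs.injOn.ncard_image, hs.image_eq]
    exact hb
  obtain ⟨S, hsS, hS⟩ := Finset.exists_superset_card_eq hcard hq
  refine ⟨S, hS, hsS (by simpa using hj₀), fun j => ?_⟩
  obtain ⟨k, hk, hkj⟩ := hs.surjOn (Set.mem_range_self j)
  exact ⟨k, hsS hk, hkj⟩

/-- A family of maps that select representatives: every partition of `ι` into at most `q` classes
consists of unions of fibres of one of them. The classes are represented by a `q`-element set
containing the base point `j₀`; fixing `j₀` is what makes the family a singleton for `q = 1`. -/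
def clusterMaps (j₀ : ι) (q : ℕ) : Finset (ι → ι) :=
  (Finset.powersetCard (q - 1) (Finset.univ.erase j₀)).biUnion fun T => retractions (insert j₀ T)

lemma card_insert_of_mem_powersetCard_erase {j₀ : ι} {q : ℕ} (hq : 1 ≤ q) {T : Finset ι}
    (hT : T ∈ Finset.powersetCard (q - 1) (Finset.univ.erase j₀)) : (insert j₀ T).card = q := by
  obtain ⟨hTsub, hTcard⟩ := Finset.mem_powersetCard.1 hT
  rw [Finset.card_insert_of_notMem fun h => Finset.notMem_erase j₀ _ (hTsub h), hTcard,
    Nat.sub_add_cancel hq]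

lemma choose_add_le_add_one_pow (a d : ℕ) : (a + d).choose d ≤ (a + 1) ^ d := by
  induction d with
  | zero => simp
  | succ d ih =>
    refine Nat.le_of_mul_le_mul_right ?_ d.succ_pos
    calc (a + d + 1).choose (d + 1) * (d + 1)
        = (a + d + 1) * (a + d).choose d := (Nat.add_one_mul_choose_eq _ _).symm
      _ ≤ ((a + 1) * (d + 1)) * (a + 1) ^ d := by gcongr; nlinarith
      _ = (a + 1) ^ (d + 1) * (d + 1) := by ring

lemma card_clusterMaps_le (j₀ : ι) {q : ℕ} (hq : 1 ≤ q) (hqι : q ≤ Fintype.card ι) :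
    (clusterMaps j₀ q).card ≤ q ^ (2 * (Fintype.card ι - q)) := by
  obtain ⟨d, hd⟩ := Nat.exists_eq_add_of_le hqι
  have hchoose : (Finset.powersetCard (q - 1) (Finset.univ.erase j₀)).card ≤ q ^ d := by
    have hsub : Fintype.card ι - 1 = q - 1 + d := by omega
    rw [Finset.card_powersetCard, Finset.card_erase_of_mem (Finset.mem_univ j₀), Finset.card_univ,
      hsub, Nat.choose_symm_add]
    simpa only [Nat.sub_add_cancel hq] using choose_add_le_add_one_pow (q - 1) d
  calc _ ≤ (Finset.powersetCard (q - 1) (Finset.univ.erase j₀)).card * q ^ d := by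
        refine Finset.card_biUnion_le_card_mul _ _ _ fun T hT => ?_
        rw [card_retractions, card_insert_of_mem_powersetCard_erase hq hT, hd,
          Nat.add_sub_cancel_left]
    _ ≤ q ^ d * q ^ d := by gcongr
    _ = q ^ (2 * (Fintype.card ι - q)) := by rw [hd, Nat.add_sub_cancel_left, two_mul, pow_add]

lemma ncard_range_le_of_mem_clusterMaps {j₀ : ι} {q : ℕ} (hq : 1 ≤ q) {F : ι → ι}
    (hF : F ∈ clusterMaps j₀ q) : (Set.range F).ncard ≤ q := by
  obtain ⟨T, hT, hFT⟩ := Finset.mem_biUnion.1 hF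
  rw [← card_insert_of_mem_powersetCard_erase hq hT, ← Set.ncard_coe_finset]
  exact Set.ncard_le_ncard (range_subset_of_mem_retractions hFT)

lemma exists_mem_clusterMaps_comp_eq {α : Type*} (b : ι → α) (j₀ : ι) {q : ℕ}
    (hb : (Set.range b).ncard ≤ q) (hqι : q ≤ Fintype.card ι) :
    ∃ F ∈ clusterMaps j₀ q, b ∘ F = b := by
  obtain ⟨S, hS, hj₀, htrans⟩ := exists_transversal b j₀ hb hqι
  obtain ⟨F, hF, hbF⟩ := exists_mem_retractions_comp_eq htrans
  refine ⟨F, Finset.mem_biUnion.2 ⟨S.erase j₀, ?_, by rwa [Finset.insert_erase hj₀]⟩, hbF⟩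
  rw [Finset.mem_powersetCard, Finset.card_erase_of_mem hj₀, hS]
  exact ⟨Finset.erase_subset_erase _ (Finset.subset_univ S), rfl⟩

end ClusterMaps

section Rank

variable {K m n : Type*} [Field K] [Fintype n]

lemma rank_add_le [Finite m] (A B : Matrix m n K) : (A + B).rank ≤ A.rank + B.rank := by
  classical
  rw [Matrix.rank_eq_finrank_span_cols, Matrix.rank_eq_finrank_span_cols A,
    Matrix.rank_eq_finrank_span_cols B]
  refine (Submodule.finrank_mono (Submodule.span_le.2 ?_)).trans
    (Submodule.finrank_add_le_finrank_add_finrank _ _)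
  rintro _ ⟨j, rfl⟩
  exact Submodule.add_mem_sup (Submodule.subset_span (Set.mem_range_self j))
    (Submodule.subset_span (Set.mem_range_self j))

lemma rank_sub_le [Finite m] (A B : Matrix m n K) : (A - B).rank ≤ A.rank + B.rank := by
  classical
  have hneg : (-B).rank ≤ B.rank := by
    have h := Matrix.rank_mul_le_left B (-1 : Matrix n n K)
    rwa [Matrix.mul_neg, Matrix.mul_one] at h
  rw [sub_eq_add_neg]
  exact (rank_add_le A (-B)).trans (Nat.add_le_add_left hneg _)

lemma rank_le_ncard_range_row [Finite m] (A : Matrix m n K) :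
    A.rank ≤ (Set.range A.row).ncard := by
  have := Fintype.ofFinite (Set.range A.row)
  rw [Matrix.rank_eq_finrank_span_row, Set.ncard_eq_toFinset_card']
  exact finrank_span_le_card _

lemma rank_one_submatrix_le [DecidableEq n] [Finite m] (F : m → n) :
    ((1 : Matrix n n K).submatrix F id).rank ≤ (Set.range F).ncard := by
  have hrange : Set.range ((1 : Matrix n n K).submatrix F id).row =
      (1 : Matrix n n K).row '' Set.range F := by
    rw [← Set.range_comp]
    rfl
  refine (rank_le_ncard_range_row _).trans ?_
  rw [hrange]
  exact Set.ncard_image_le (Set.toFinite _)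

end Rank

section Frobenius

variable {n m : ℕ}

/-- The columns of a matrix, as a vector of the Hilbert space `(ℝⁿ)ᵐ`; it turns the Frobenius
inner product into an inner product known to the library. -/
def columns : Matrix (Fin n) (Fin m) ℝ ≃ₗ[ℝ] PiLp 2 fun _ : Fin m => EuclideanSpace ℝ (Fin n) where
  toFun A := WithLp.toLp 2 fun l => WithLp.toLp 2 fun i => A i l
  invFun v := Matrix.of fun i l => v l i
  map_add' _ _ := rfl
  map_smul' _ _ := rfl
  left_inv _ := rfl
  right_inv _ := rfl

lemma columns_apply (A : Matrix (Fin n) (Fin m) ℝ) (l : Fin m) (i : Fin n) :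
    columns A l i = A i l := rfl

lemma frobInner_eq_inner (A B : Matrix (Fin n) (Fin m) ℝ) :
    frobInner A B = inner ℝ (columns A) (columns B) := by
  simp only [frobInner, PiLp.inner_apply, columns_apply, RCLike.inner_apply, conj_trivial]
  rw [Finset.sum_comm]
  simp only [mul_comm]

lemma frobSq_eq_norm_sq (A : Matrix (Fin n) (Fin m) ℝ) : frobSq A = ‖columns A‖ ^ 2 := by
  simp only [PiLp.norm_sq_eq_of_L2, columns_apply, Real.norm_eq_abs, sq_abs]
  exact Finset.sum_comm

lemma sqrt_frobSq (A : Matrix (Fin n) (Fin m) ℝ) : √(frobSq A) = ‖columns A‖ := by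
  rw [frobSq_eq_norm_sq, Real.sqrt_sq (norm_nonneg _)]

lemma frobSq_nonneg (A : Matrix (Fin n) (Fin m) ℝ) : 0 ≤ frobSq A := by
  rw [frobSq_eq_norm_sq]
  positivity

/-- The column space of a matrix. -/
def colSpace (A : Matrix (Fin n) (Fin m) ℝ) : Submodule ℝ (EuclideanSpace ℝ (Fin n)) :=
  Submodule.span ℝ (Set.range (columns A).ofLp)

lemma finrank_colSpace (A : Matrix (Fin n) (Fin m) ℝ) : Module.finrank ℝ (colSpace A) = A.rank := by
  let e := (WithLp.linearEquiv 2 ℝ (Fin n → ℝ)).symm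
  have hmap : colSpace A = (Submodule.span ℝ (Set.range A.col)).map e.toLinearMap := by
    rw [Submodule.map_span, ← Set.range_comp]
    rfl
  rw [Matrix.rank_eq_finrank_span_cols, hmap]
  exact e.finrank_map_eq _

lemma columns_mul_mem_colSpace {p : ℕ} (A : Matrix (Fin n) (Fin p) ℝ)
    (C : Matrix (Fin p) (Fin m) ℝ) (l : Fin m) : columns (A * C) l ∈ colSpace A := by
  have hsum : columns (A * C) l = ∑ k, C k l • columns A k := by
    ext i
    simp [columns_apply, Matrix.mul_apply, mul_comm]
  rw [hsum]
  exact Submodule.sum_mem _ fun k _ =>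
    Submodule.smul_mem _ _ (Submodule.subset_span (Set.mem_range_self k))

/-- The isometric inclusion of `ℓ²(ι, W)` into `ℓ²(ι, V)`, for a subspace `W` of `V`. -/
def piLpSubtype (ι : Type*) [Fintype ι] {V : Type*} [NormedAddCommGroup V] [InnerProductSpace ℝ V]
    (W : Submodule ℝ V) : (PiLp 2 fun _ : ι => W) →ₗᵢ[ℝ] PiLp 2 fun _ : ι => V where
  toFun v := WithLp.toLp 2 fun l => v l
  map_add' _ _ := rfl
  map_smul' _ _ := rfl
  norm_map' v := by
    rw [PiLp.norm_eq_of_L2, PiLp.norm_eq_of_L2]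
    rfl

lemma exists_lowRank_matrix_net (W : Submodule ℝ (EuclideanSpace ℝ (Fin n))) (m k : ℕ) :
    ∃ s : Finset (Matrix (Fin n) (Fin m) ℝ), s.card ≤ 5 ^ (k * (Module.finrank ℝ W + m)) ∧
      (∀ A ∈ s, frobSq A ≤ 1) ∧
      ∀ A : Matrix (Fin n) (Fin m) ℝ, A.rank ≤ k → (∀ l, columns A l ∈ W) →
        ∀ E, ∃ A' ∈ s, frobInner E A ≤ 4 * √(frobSq A) * frobInner E A' := by
  classical
  obtain ⟨s, hcard, hball, hnet⟩ := exists_lowRank_net (Fin m) W k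
  let ψ := piLpSubtype (Fin m) W
  refine ⟨s.image fun y => columns.symm (ψ y), ?_, ?_, fun A hA hAW E => ?_⟩
  · rw [Fintype.card_fin] at hcard
    exact Finset.card_image_le.trans hcard
  · intro A hA
    obtain ⟨y, hy, rfl⟩ := Finset.mem_image.1 hA
    rw [frobSq_eq_norm_sq, LinearEquiv.apply_symm_apply, ψ.norm_map]
    exact pow_le_one₀ (norm_nonneg y) (mem_closedBall_zero_iff.1 (hball hy))
  · let v : PiLp 2 fun _ : Fin m => W := WithLp.toLp 2 fun l => ⟨columns A l, hAW l⟩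
    have hv : ψ v = columns A := rfl
    have hrank : Module.finrank ℝ (Submodule.span ℝ (Set.range v.ofLp)) ≤ k := by
      refine le_of_eq_of_le ?_ hA
      rw [← finrank_colSpace, ← Submodule.finrank_map_subtype_eq, Submodule.map_span,
        ← Set.range_comp]
      rfl
    obtain ⟨y, hy, hle⟩ := hnet v hrank (innerₗ _ (columns E) ∘ₗ ψ.toLinearMap)
    refine ⟨_, Finset.mem_image_of_mem _ hy, ?_⟩
    rw [frobInner_eq_inner, frobInner_eq_inner, LinearEquiv.apply_symm_apply, sqrt_frobSq, ← hv,
      ψ.norm_map]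
    exact hle

end Frobenius

section FeasibleNet

variable {n p m q r : ℕ}

lemma exists_mem_clusterMaps_mul_eq {B : Matrix (Fin p) (Fin m) ℝ} (hB : numRows B ≤ q)
    (hqp : q ≤ p) (j₀ : Fin p) :
    ∃ F ∈ clusterMaps j₀ q, (1 : Matrix (Fin p) (Fin p) ℝ).submatrix F id * B = B := by
  obtain ⟨F, hF, hBF⟩ := exists_mem_clusterMaps_comp_eq (fun j => B j) j₀ hB
    (hqp.trans_eq (Fintype.card_fin p).symm)
  exact ⟨F, hF, (Matrix.one_submatrix_mul F (Equiv.refl _) B).trans hBF⟩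

lemma rank_mul_one_submatrix_le (X : Matrix (Fin n) (Fin p) ℝ) {F : Fin p → Fin p}
    (hF : (Set.range F).ncard ≤ q) :
    (X * (1 : Matrix (Fin p) (Fin p) ℝ).submatrix F id).rank ≤ min q X.rank :=
  le_min ((Matrix.rank_mul_le_right _ _).trans ((rank_one_submatrix_le F).trans hF))
    (Matrix.rank_mul_le_left _ _)

lemma sub_mul_log_nonneg (hqp : q ≤ p) : 0 ≤ ((p : ℝ) - q) * Real.log q :=
  mul_nonneg (sub_nonneg.2 (Nat.cast_le.2 hqp)) (Real.log_natCast_nonneg q)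

lemma pow_mul_five_pow_le_exp_complexity (X : Matrix (Fin n) (Fin p) ℝ) (m r : ℕ) (hq : 1 ≤ q)
    (hqp : q ≤ p) :
    (q : ℝ) ^ (2 * (p - q)) * 5 ^ (2 * r * (2 * min q X.rank + m)) ≤
      Real.exp (8 * complexity m X q r) := by
  have hq0 : (0 : ℝ) < q := by exact_mod_cast hq
  have hlog5 : Real.log 5 ≤ 2 := by
    rw [Real.log_le_iff_le_exp (by norm_num)]
    calc (5 : ℝ) ≤ 2.7 ^ 2 := by norm_num
      _ ≤ Real.exp 1 ^ 2 := by gcongr; exact Real.exp_one_gt_d9.le.trans' (by norm_num)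
      _ = Real.exp 2 := by rw [← Real.exp_nat_mul]; norm_num
  have hexp : ∀ {x : ℝ} (k : ℕ), 0 < x → x ^ k = Real.exp (k * Real.log x) := fun k hx => by
    rw [Real.exp_nat_mul, Real.exp_log hx]
  rw [hexp _ hq0, hexp _ (by norm_num : (0 : ℝ) < 5), ← Real.exp_add, Real.exp_le_exp]
  push_cast [Nat.cast_sub hqp]
  calc 2 * ((p : ℝ) - q) * Real.log q + 2 * r * (2 * min (q : ℝ) X.rank + m) * Real.log 5
      ≤ 2 * ((p : ℝ) - q) * Real.log q + 2 * r * (2 * min (q : ℝ) X.rank + m) * 2 := by gcongr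
    _ ≤ 8 * complexity m X q r := by
      have hlogq := sub_mul_log_nonneg hqp
      have hmr : (0 : ℝ) ≤ m * r := by positivity
      rw [complexity]
      push_cast
      linarith

lemma exists_feasible_net (X : Matrix (Fin n) (Fin p) ℝ) (hq : 1 ≤ q) (hqp : q ≤ p)
    {B : Matrix (Fin p) (Fin m) ℝ} (hB : B ∈ feasible p m q r) :
    ∃ s : Finset (Matrix (Fin n) (Fin m) ℝ),
      (s.card : ℝ) ≤ Real.exp (8 * complexity m X q r) ∧ (∀ A ∈ s, frobSq A ≤ 1) ∧
      ∀ B₁ ∈ feasible p m q r, ∀ E, ∃ A ∈ s,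
        frobInner E (X * B₁ - X * B) ≤ 4 * √(frobSq (X * B₁ - X * B)) * frobInner E A := by
  classical
  let j₀ : Fin p := ⟨0, by omega⟩
  let S (F : Fin p → Fin p) : Matrix (Fin p) (Fin p) ℝ := Matrix.submatrix 1 F id
  obtain ⟨F₀, hF₀, hBF₀⟩ := exists_mem_clusterMaps_mul_eq hB.2 hqp j₀
  have hdim : ∀ F ∈ clusterMaps j₀ q,
      Module.finrank ℝ ↥(colSpace (X * S F) ⊔ colSpace (X * S F₀)) ≤ 2 * min q X.rank := by
    intro F hF
    refine (Submodule.finrank_add_le_finrank_add_finrank _ _).trans ?_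
    rw [finrank_colSpace, finrank_colSpace, two_mul]
    gcongr <;> exact rank_mul_one_submatrix_le X (ncard_range_le_of_mem_clusterMaps hq ‹_›)
  choose net hcard hunit hnet using fun F : Fin p → Fin p =>
    exists_lowRank_matrix_net (colSpace (X * S F) ⊔ colSpace (X * S F₀)) m (2 * r)
  refine ⟨(clusterMaps j₀ q).biUnion net, ?_, ?_, fun B₁ hB₁ E => ?_⟩
  · refine le_trans ?_ (pow_mul_five_pow_le_exp_complexity X m r hq hqp)
    have hmaps := card_clusterMaps_le j₀ hq (hqp.trans_eq (Fintype.card_fin p).symm)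
    rw [Fintype.card_fin] at hmaps
    have hle : ((clusterMaps j₀ q).biUnion net).card ≤
        q ^ (2 * (p - q)) * 5 ^ (2 * r * (2 * min q X.rank + m)) := by
      refine (Finset.card_biUnion_le_card_mul _ _ _ fun F hF => (hcard F).trans ?_).trans
        (Nat.mul_le_mul_right _ hmaps)
      gcongr
      exacts [Nat.one_le_ofNat, hdim F hF]
    exact_mod_cast hle
  · intro A hA
    obtain ⟨F, -, hA⟩ := Finset.mem_biUnion.1 hA
    exact hunit F A hA
  · obtain ⟨F, hF, hBF⟩ := exists_mem_clusterMaps_mul_eq hB₁.2 hqp j₀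
    have hrank : (X * B₁ - X * B).rank ≤ 2 * r := by
      rw [← Matrix.mul_sub, two_mul]
      exact (Matrix.rank_mul_le_right _ _).trans
        ((rank_sub_le _ _).trans (Nat.add_le_add hB₁.1 hB.1))
    have hcol : ∀ l, columns (X * B₁ - X * B) l ∈ colSpace (X * S F) ⊔ colSpace (X * S F₀) := by
      intro l
      rw [← hBF, ← hBF₀, ← Matrix.mul_assoc, ← Matrix.mul_assoc, map_sub]
      exact Submodule.sub_mem_sup (columns_mul_mem_colSpace _ _ l) (columns_mul_mem_colSpace _ _ l)
    obtain ⟨A, hA, hle⟩ := hnet F _ hrank hcol E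
    exact ⟨A, Finset.mem_biUnion.2 ⟨F, hF, hA⟩, hle⟩

end FeasibleNet

section SubGaussian

variable {Ω : Type*} [MeasurableSpace Ω] {P : Measure Ω}

lemma lintegral_exp_sq_le_two {Z : Ω → ℝ} {t : ℝ} (h : psi2Norm P Z < ENNReal.ofReal t) :
    ∫⁻ ω, ENNReal.ofReal (Real.exp ((Z ω / t) ^ 2)) ∂P ≤ 2 := by
  simp only [psi2Norm, iInf_lt_iff] at h
  obtain ⟨t', ht', hint, hlt⟩ := h
  have htt' : t' ≤ t := (ENNReal.lt_ofReal_iff_toReal_lt ENNReal.ofReal_ne_top).1 hlt |>.le.trans'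
    (ENNReal.toReal_ofReal ht'.le).ge
  refine (lintegral_mono fun ω => ENNReal.ofReal_le_ofReal (Real.exp_le_exp.2 ?_)).trans hint
  rw [div_pow, div_pow]
  gcongr

lemma aemeasurable_exp_sq {Z : Ω → ℝ} (hZ : AEMeasurable Z P) (t : ℝ) :
    AEMeasurable (fun ω => ENNReal.ofReal (Real.exp ((Z ω / t) ^ 2))) P := by
  fun_prop

lemma psi2Norm_lt_of_lt {Z : Ω → ℝ} {σ t : ℝ} (hσ : 0 ≤ σ) (h : psi2Norm P Z ≤ ENNReal.ofReal σ)
    (ht : σ < t) : psi2Norm P Z < ENNReal.ofReal t :=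
  h.trans_lt ((ENNReal.ofReal_lt_ofReal_iff (hσ.trans_lt ht)).2 ht)

lemma measure_sq_ge_le_of_psi2Norm_lt {Z : Ω → ℝ} {t : ℝ} (hZ : AEMeasurable Z P) (ht : 0 < t)
    (h : psi2Norm P Z < ENNReal.ofReal t) (u : ℝ) :
    P {ω | t ^ 2 * u ≤ Z ω ^ 2} ≤ ENNReal.ofReal (2 * Real.exp (-u)) := by
  have hsub : {ω | t ^ 2 * u ≤ Z ω ^ 2} ⊆
      {ω | ENNReal.ofReal (Real.exp u) ≤ ENNReal.ofReal (Real.exp ((Z ω / t) ^ 2))} := by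
    intro ω (hω : t ^ 2 * u ≤ Z ω ^ 2)
    refine ENNReal.ofReal_le_ofReal (Real.exp_le_exp.2 ?_)
    rwa [div_pow, le_div_iff₀' (by positivity)]
  have hexp : ENNReal.ofReal (Real.exp u) ≠ 0 := by
    simpa only [ne_eq, ENNReal.ofReal_eq_zero, not_le] using Real.exp_pos u
  calc P {ω | t ^ 2 * u ≤ Z ω ^ 2}
      ≤ (∫⁻ ω, ENNReal.ofReal (Real.exp ((Z ω / t) ^ 2)) ∂P) / ENNReal.ofReal (Real.exp u) :=
        (measure_mono hsub).trans
          (meas_ge_le_lintegral_div (aemeasurable_exp_sq hZ t) hexp ENNReal.ofReal_ne_top)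
    _ ≤ 2 / ENNReal.ofReal (Real.exp u) := by gcongr; exact lintegral_exp_sq_le_two h
    _ = ENNReal.ofReal (2 * Real.exp (-u)) := by
        rw [Real.exp_neg, ← div_eq_mul_inv, ENNReal.ofReal_div_of_pos (Real.exp_pos u),
          ENNReal.ofReal_ofNat]

lemma measure_sq_gt_le {Z : Ω → ℝ} {σ u : ℝ} (hZ : AEMeasurable Z P) (hσ : 0 ≤ σ)
    (h : psi2Norm P Z ≤ ENNReal.ofReal σ) (hu : 0 ≤ u) :
    P {ω | σ ^ 2 * u < Z ω ^ 2} ≤ ENNReal.ofReal (2 * Real.exp (-u)) := by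
  let t (k : ℕ) : ℝ := σ + 1 / (k + 1)
  have ht (k : ℕ) : σ < t k := lt_add_of_pos_right σ Nat.one_div_pos_of_nat
  have hmono : Monotone fun k => {ω | t k ^ 2 * u ≤ Z ω ^ 2} := by
    intro k l hkl ω (hω : t k ^ 2 * u ≤ Z ω ^ 2)
    have htl : t l ≤ t k := add_le_add_right (Nat.one_div_le_one_div hkl) σ
    have : 0 ≤ t l := hσ.trans (ht l).le
    exact hω.trans' (by gcongr)
  have hsub : {ω | σ ^ 2 * u < Z ω ^ 2} ⊆ ⋃ k, {ω | t k ^ 2 * u ≤ Z ω ^ 2} := by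
    intro ω hω
    have hlim : Tendsto (fun k => t k ^ 2 * u) atTop (𝓝 (σ ^ 2 * u)) := by
      have h := ((tendsto_one_div_add_atTop_nhds_zero_nat.const_add σ).pow 2).mul_const u
      rwa [add_zero] at h
    obtain ⟨k, hk⟩ := (hlim.eventually_le_const hω).exists
    exact Set.mem_iUnion.2 ⟨k, hk⟩
  calc _ ≤ ⨆ k, P {ω | t k ^ 2 * u ≤ Z ω ^ 2} :=
        (measure_mono hsub).trans_eq hmono.measure_iUnion
    _ ≤ _ := iSup_le fun k => measure_sq_ge_le_of_psi2Norm_lt hZ (hσ.trans_lt (ht k))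
        (psi2Norm_lt_of_lt hσ h (ht k)) u

variable {ι : Type*} {s : Finset ι} {Z : ι → Ω → ℝ} {σ : ℝ}

lemma measure_exists_sq_gt_le (hZ : ∀ i ∈ s, AEMeasurable (Z i) P) (hσ : 0 ≤ σ)
    (h : ∀ i ∈ s, psi2Norm P (Z i) ≤ ENNReal.ofReal σ) {u : ℝ} (hu : 0 ≤ u) :
    P {ω | ∃ i ∈ s, σ ^ 2 * u < Z i ω ^ 2} ≤ ENNReal.ofReal (s.card * (2 * Real.exp (-u))) := by
  have hset : {ω | ∃ i ∈ s, σ ^ 2 * u < Z i ω ^ 2} = ⋃ i ∈ s, {ω | σ ^ 2 * u < Z i ω ^ 2} := by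
    ext ω
    simp only [Set.mem_ofPred_eq, Set.mem_iUnion, exists_prop]
  calc _ ≤ ∑ i ∈ s, P {ω | σ ^ 2 * u < Z i ω ^ 2} := hset ▸ measure_biUnion_finset_le _ _
    _ ≤ ∑ i ∈ s, ENNReal.ofReal (2 * Real.exp (-u)) :=
        Finset.sum_le_sum fun i hi => measure_sq_gt_le (hZ i hi) hσ (h i hi) hu
    _ = _ := by
        rw [Finset.sum_const, nsmul_eq_mul, ENNReal.ofReal_mul (Nat.cast_nonneg _),
          ENNReal.ofReal_natCast]

lemma sq_le_mul_add_exp_neg_mul_exp (z K : ℝ) {t : ℝ} (ht : t ≠ 0) :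
    z ^ 2 ≤ t ^ 2 * (K + Real.exp (-K) * Real.exp ((z / t) ^ 2)) := by
  have hexp := Real.add_one_le_exp (-K + (z / t) ^ 2)
  rw [Real.exp_add] at hexp
  calc z ^ 2 = t ^ 2 * (z / t) ^ 2 := by field_simp
    _ ≤ _ := by gcongr; linarith

lemma lintegral_iSup_sq_le_of_psi2Norm_lt [IsProbabilityMeasure P] {t : ℝ}
    (hZ : ∀ i ∈ s, AEMeasurable (Z i) P) (ht : 0 < t)
    (h : ∀ i ∈ s, psi2Norm P (Z i) < ENNReal.ofReal t) {K : ℝ} (hK : 0 ≤ K)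
    (hs : (s.card : ℝ) ≤ Real.exp K) :
    ∫⁻ ω, ⨆ i ∈ s, ENNReal.ofReal (Z i ω ^ 2) ∂P ≤ ENNReal.ofReal (t ^ 2 * (K + 2)) := by
  let e (i : ι) (ω : Ω) : ℝ≥0∞ := ENNReal.ofReal (Real.exp ((Z i ω / t) ^ 2))
  have he : ∀ i ∈ s, AEMeasurable (e i) P := fun i hi => aemeasurable_exp_sq (hZ i hi) t
  have hpt (ω : Ω) : ⨆ i ∈ s, ENNReal.ofReal (Z i ω ^ 2) ≤
      ENNReal.ofReal (t ^ 2) *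
        (ENNReal.ofReal K + ENNReal.ofReal (Real.exp (-K)) * ∑ i ∈ s, e i ω) := by
    refine iSup₂_le fun i hi => ?_
    calc _ ≤ ENNReal.ofReal (t ^ 2 * (K + Real.exp (-K) * Real.exp ((Z i ω / t) ^ 2))) :=
          ENNReal.ofReal_le_ofReal (sq_le_mul_add_exp_neg_mul_exp _ _ ht.ne')
      _ = ENNReal.ofReal (t ^ 2) * (ENNReal.ofReal K + ENNReal.ofReal (Real.exp (-K)) * e i ω) := by
          rw [ENNReal.ofReal_mul (by positivity), ENNReal.ofReal_add hK (by positivity),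
            ENNReal.ofReal_mul (by positivity)]
      _ ≤ _ := by
          gcongr
          exact Finset.single_le_sum (f := fun i => e i ω) (fun _ _ => zero_le) hi
  have hint : ENNReal.ofReal (Real.exp (-K)) * ∑ i ∈ s, ∫⁻ ω, e i ω ∂P ≤ 2 := by
    calc _ ≤ ENNReal.ofReal (Real.exp (-K)) * (ENNReal.ofReal (Real.exp K) * 2) := by
          gcongr
          refine (Finset.sum_le_card_nsmul s _ 2 fun i hi =>
            lintegral_exp_sq_le_two (h i hi)).trans ?_
          rw [nsmul_eq_mul, ← ENNReal.ofReal_natCast]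
          gcongr
      _ = 2 := by
          rw [← mul_assoc, ← ENNReal.ofReal_mul (Real.exp_nonneg _), ← Real.exp_add,
            neg_add_cancel, Real.exp_zero, ENNReal.ofReal_one, one_mul]
  have hsum : AEMeasurable (fun ω => ∑ i ∈ s, e i ω) P := Finset.aemeasurable_fun_sum s he
  calc _ ≤ ENNReal.ofReal (t ^ 2) *
        (ENNReal.ofReal K + ENNReal.ofReal (Real.exp (-K)) * ∑ i ∈ s, ∫⁻ ω, e i ω ∂P) := by
        refine (lintegral_mono hpt).trans_eq ?_
        rw [lintegral_const_mul'' _ ((hsum.const_mul _).const_add _),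
          lintegral_add_left' aemeasurable_const, lintegral_const_mul'' _ hsum,
          lintegral_finsetSum' _ he, lintegral_const, measure_univ, mul_one]
    _ ≤ ENNReal.ofReal (t ^ 2) * (ENNReal.ofReal K + 2) := by gcongr
    _ = _ := by
        rw [ENNReal.ofReal_mul (by positivity), ENNReal.ofReal_add hK zero_le_two,
          ENNReal.ofReal_ofNat]

lemma lintegral_iSup_sq_le [IsProbabilityMeasure P] (hZ : ∀ i ∈ s, AEMeasurable (Z i) P)
    (hσ : 0 ≤ σ) (h : ∀ i ∈ s, psi2Norm P (Z i) ≤ ENNReal.ofReal σ) {K : ℝ} (hK : 0 ≤ K)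
    (hs : (s.card : ℝ) ≤ Real.exp K) :
    ∫⁻ ω, ⨆ i ∈ s, ENNReal.ofReal (Z i ω ^ 2) ∂P ≤ ENNReal.ofReal (σ ^ 2 * (K + 2)) := by
  have hlim : Tendsto (fun t : ℝ => ENNReal.ofReal (t ^ 2 * (K + 2))) (𝓝[>] σ)
      (𝓝 (ENNReal.ofReal (σ ^ 2 * (K + 2)))) :=
    tendsto_nhdsWithin_of_tendsto_nhds <| (ENNReal.continuous_ofReal.comp
      (by fun_prop : Continuous fun t : ℝ => t ^ 2 * (K + 2))).tendsto σ
  refine ge_of_tendsto hlim ?_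
  filter_upwards [self_mem_nhdsWithin] with t (ht : σ < t)
  exact lintegral_iSup_sq_le_of_psi2Norm_lt hZ (hσ.trans_lt ht)
    (fun i hi => psi2Norm_lt_of_lt hσ (h i hi) ht) hK hs

end SubGaussian

section Bregman

variable {n p m q r : ℕ} {μ : ℝ} {f : Matrix (Fin n) (Fin m) ℝ → ℝ} {X : Matrix (Fin n) (Fin p) ℝ}

lemma StronglyConvex.le_bregman (hf : StronglyConvex μ f) (α β : Matrix (Fin n) (Fin m) ℝ) :
    μ / 2 * frobSq (α - β) ≤ bregman f α β := by
  have h := hf.2 β α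
  rw [bregman]
  linarith

lemma StronglyConvex.bregman_nonneg (hf : StronglyConvex μ f) (hμ : 0 ≤ μ)
    (α β : Matrix (Fin n) (Fin m) ℝ) : 0 ≤ bregman f α β :=
  (mul_nonneg (div_nonneg hμ zero_le_two) (frobSq_nonneg _)).trans (hf.le_bregman α β)

lemma bregman_self (α : Matrix (Fin n) (Fin m) ℝ) : bregman f α α = 0 := by
  rw [bregman, frobInner_eq_inner, sub_self, sub_self, map_zero, inner_zero_right, sub_zero]

lemma frobSq_sub_le (α β γ : Matrix (Fin n) (Fin m) ℝ) :
    frobSq (α - γ) ≤ 2 * (frobSq (α - β) + frobSq (γ - β)) := by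
  simp only [frobSq_eq_norm_sq, map_sub]
  calc _ ≤ (‖columns α - columns β‖ + ‖columns γ - columns β‖) ^ 2 := by
        gcongr
        rw [norm_sub_rev (columns γ)]
        exact norm_sub_le_norm_sub_add_norm_sub _ _ _
    _ ≤ _ := add_sq_le

lemma IsGlobalCRL.bregman_le {Bhat B : Matrix (Fin p) (Fin m) ℝ} (hBhat : IsGlobalCRL X f q r Bhat)
    (hB : B ∈ feasible p m q r) (η : Matrix (Fin n) (Fin m) ℝ) :
    bregman f (X * Bhat) η ≤
      bregman f (X * B) η + frobInner (-grad f η) (X * Bhat - X * B) := by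
  have hmin : f (X * Bhat) ≤ f (X * B) := hBhat.2 hB
  simp only [bregman, frobInner_eq_inner, map_sub, map_neg, inner_sub_right, inner_neg_left]
  linarith

lemma four_mul_mul_le_add_sq (hμ : 0 < μ) (a z : ℝ) :
    4 * a * z ≤ μ / 8 * a ^ 2 + 32 / μ * z ^ 2 := by
  have hsq : μ / 8 * a ^ 2 + 32 / μ * z ^ 2 - 4 * a * z = (μ * a - 16 * z) ^ 2 / (8 * μ) := by
    field_simp
    ring
  rw [← sub_nonneg, hsq]
  positivity

lemma IsGlobalCRL.bregman_le_of_frobInner_le (hf : StronglyConvex μ f) (hμ : 0 < μ)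
    {Bhat B : Matrix (Fin p) (Fin m) ℝ} (hBhat : IsGlobalCRL X f q r Bhat)
    (hB : B ∈ feasible p m q r) {η : Matrix (Fin n) (Fin m) ℝ} {z : ℝ}
    (hz : frobInner (-grad f η) (X * Bhat - X * B) ≤ 4 * √(frobSq (X * Bhat - X * B)) * z) :
    bregman f (X * Bhat) η ≤ 3 * bregman f (X * B) η + 64 / μ * z ^ 2 := by
  have hbasic := hBhat.bregman_le hB η
  have hyoung := four_mul_mul_le_add_sq hμ √(frobSq (X * Bhat - X * B)) z
  rw [Real.sq_sqrt (frobSq_nonneg _)] at hyoung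
  have hdist : μ / 8 * frobSq (X * Bhat - X * B) ≤
      (bregman f (X * Bhat) η + bregman f (X * B) η) / 2 := by
    calc _ ≤ μ / 8 * (2 * (frobSq (X * Bhat - η) + frobSq (X * B - η))) := by
          gcongr
          exact frobSq_sub_le _ _ _
      _ = (μ / 2 * frobSq (X * Bhat - η) + μ / 2 * frobSq (X * B - η)) / 2 := by ring
      _ ≤ _ := by gcongr <;> exact hf.le_bregman _ _
  have hdouble : 64 / μ * z ^ 2 = 2 * (32 / μ * z ^ 2) := by ring
  linarith

lemma IsGlobalCRL.frobSq_le_of_frobInner_le (hf : StronglyConvex μ f) (hμ : 0 < μ)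
    {Bhat B : Matrix (Fin p) (Fin m) ℝ} (hBhat : IsGlobalCRL X f q r Bhat)
    (hB : B ∈ feasible p m q r) {z : ℝ}
    (hz : frobInner (-grad f (X * B)) (X * Bhat - X * B) ≤
      4 * √(frobSq (X * Bhat - X * B)) * z) :
    frobSq (X * (Bhat - B)) ≤ 128 / μ ^ 2 * z ^ 2 := by
  have hD := (hf.le_bregman _ _).trans (hBhat.bregman_le_of_frobInner_le hf hμ hB hz)
  rw [bregman_self, mul_zero, zero_add] at hD
  rw [Matrix.mul_sub]
  calc frobSq (X * Bhat - X * B) = 2 / μ * (μ / 2 * frobSq (X * Bhat - X * B)) := by field_simp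
    _ ≤ 2 / μ * (64 / μ * z ^ 2) := by gcongr
    _ = _ := by ring

end Bregman

section Complexity

variable {n p m q r q' r' : ℕ} {X : Matrix (Fin n) (Fin p) ℝ}

lemma complexity_nonneg (hqp : q ≤ p) : 0 ≤ complexity m X q r :=
  add_nonneg (by positivity) (sub_mul_log_nonneg hqp)

lemma half_le_log_of_one_lt (hq : 1 < q) : 1 / 2 ≤ Real.log q :=
  calc (1 / 2 : ℝ) ≤ Real.log 2 := by linarith [Real.log_two_gt_d9]
    _ ≤ Real.log q := Real.log_le_log two_pos (Nat.ofNat_le_cast.2 hq)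

variable {ϑ : ℝ}

lemma log_mul_le_sq_mul_log (hϑ : 1 ≤ ϑ) (hq : 1 < q) :
    Real.log (ϑ * q) ≤ ϑ ^ 2 * Real.log q := by
  have hlogq := half_le_log_of_one_lt hq
  have hlogϑ := Real.log_le_sub_one_of_pos (zero_lt_one.trans_le hϑ)
  rw [Real.log_mul (by positivity) (by positivity)]
  nlinarith [sq_nonneg (ϑ - 1)]

lemma sub_mul_log_le_sq_mul (hϑ : 1 ≤ ϑ) (hq : 1 < q) (hqp : q' ≤ p) (hq' : (q' : ℝ) = ϑ * q) :
    ((p : ℝ) - q') * Real.log q' ≤ ϑ ^ 2 * (((p : ℝ) - q) * Real.log q) := by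
  have hqq' : (q : ℝ) ≤ q' := hq' ▸ le_mul_of_one_le_left q.cast_nonneg hϑ
  have hlog : Real.log q' ≤ ϑ ^ 2 * Real.log q := hq' ▸ log_mul_le_sq_mul_log hϑ hq
  calc _ ≤ ((p : ℝ) - q') * (ϑ ^ 2 * Real.log q) :=
        mul_le_mul_of_nonneg_left hlog (sub_nonneg.2 (Nat.cast_le.2 hqp))
    _ ≤ ((p : ℝ) - q) * (ϑ ^ 2 * Real.log q) := by gcongr
    _ = _ := by ring

lemma complexity_le_sq_mul (hϑ : 1 ≤ ϑ) (hq : 1 < q) (hqp : q' ≤ p) (hr' : (r' : ℝ) = ϑ * r)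
    (hq' : (q' : ℝ) = ϑ * q) : complexity m X q' r' ≤ ϑ ^ 2 * complexity m X q r := by
  have hmin : ((min q' X.rank : ℕ) : ℝ) ≤ ϑ * (min q X.rank : ℕ) := by
    rw [Nat.cast_min, Nat.cast_min, hq', mul_min_of_nonneg _ _ (zero_le_one.trans hϑ)]
    exact min_le_min_left _ (le_mul_of_one_le_left X.rank.cast_nonneg hϑ)
  calc _ ≤ (ϑ * (min q X.rank : ℕ) + ϑ * m) * (ϑ * r) +
        ϑ ^ 2 * (((p : ℝ) - q) * Real.log q) := by
        rw [complexity, hr']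
        refine add_le_add ?_ (sub_mul_log_le_sq_mul hϑ hq hqp hq')
        gcongr
        exact le_mul_of_one_le_left m.cast_nonneg hϑ
    _ = _ := by rw [complexity]; ring

lemma half_mul_add_rank_le_complexity (hq : 1 < q) (hqp : q ≤ p) (hr : 0 < r) :
    1 / 2 * ((m : ℝ) + X.rank) ≤ complexity m X q r := by
  have hX : X.rank ≤ p := X.rank_le_card_width.trans_eq (Fintype.card_fin p)
  have hrank : (X.rank : ℝ) ≤ 2 * (min q X.rank : ℕ) + ((p : ℝ) - q) := by
    have h : X.rank + q ≤ 2 * min q X.rank + p := by omega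
    have h' : (X.rank : ℝ) + q ≤ 2 * (min q X.rank : ℕ) + p := by exact_mod_cast h
    linarith
  have hlog : ((p : ℝ) - q) * (1 / 2) ≤ ((p : ℝ) - q) * Real.log q :=
    mul_le_mul_of_nonneg_left (half_le_log_of_one_lt hq) (sub_nonneg.2 (Nat.cast_le.2 hqp))
  have hdim : ((min q X.rank : ℕ) : ℝ) + m ≤ ((min q X.rank : ℕ) + m) * r :=
    le_mul_of_one_le_right (by positivity) (Nat.one_le_cast.2 hr)
  rw [complexity]
  linarith [m.cast_nonneg (α := ℝ)]

end Complexity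

section Rows

variable {p m : ℕ}

lemma numRows_sub_le (A B : Matrix (Fin p) (Fin m) ℝ) :
    numRows (A - B) ≤ numRows A * numRows B := by
  rw [numRows, numRows, numRows, ← Set.ncard_prod]
  refine (Set.ncard_le_ncard ?_ (Set.toFinite _)).trans
    (Set.ncard_image_le (f := fun x => x.1 - x.2))
  rintro _ ⟨j, rfl⟩
  exact ⟨(A j, B j), ⟨⟨j, rfl⟩, ⟨j, rfl⟩⟩, rfl⟩

lemma numRows_le (B : Matrix (Fin p) (Fin m) ℝ) : numRows B ≤ p := by
  rw [numRows, ← Set.image_univ]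
  exact (Set.ncard_image_le (Set.toFinite _)).trans_eq (by rw [Set.ncard_univ, Nat.card_fin])

lemma rank_pos_of_one_lt_numRows {B : Matrix (Fin p) (Fin m) ℝ} (h : 1 < numRows B) :
    0 < B.rank := by
  obtain ⟨_, ⟨j, rfl⟩, _, ⟨k, rfl⟩, hne⟩ := Set.one_lt_ncard_iff_nontrivial.1 h
  contrapose! hne
  rw [Matrix.rank_eq_finrank_span_cols, Nat.le_zero, Submodule.finrank_eq_zero,
    Submodule.span_eq_bot] at hne
  have hcol (l : Fin m) : B.col l = 0 := hne _ (Set.mem_range_self l)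
  ext l
  exact (congrFun (hcol l) j).trans (congrFun (hcol l) k).symm

lemma sum_row_sq_le (A : Matrix (Fin p) (Fin m) ℝ) (j : Fin p) :
    ∑ l, A j l ^ 2 ≤ twoInfNorm A ^ 2 := by
  have hle : √(∑ l, A j l ^ 2) ≤ twoInfNorm A :=
    le_ciSup (f := fun j => √(∑ l, A j l ^ 2)) (Set.finite_range _).bddAbove j
  exact (Real.sqrt_le_iff.1 hle).2

lemma row_eq_of_row_eq {B Bstar : Matrix (Fin p) (Fin m) ℝ} {R : ℝ}
    (hR : twoInfNorm (B - Bstar) ^ 2 ≤ R)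
    (hsep : ∀ j k, Bstar j ≠ Bstar k → 4 * R < ∑ l, (Bstar j l - Bstar k l) ^ 2) {j k : Fin p}
    (h : B j = B k) : Bstar j = Bstar k := by
  by_contra hne
  have hrow (i : Fin p) : ∑ l, (B - Bstar) i l ^ 2 ≤ R := (sum_row_sq_le _ i).trans hR
  have hle : ∑ l, (Bstar j l - Bstar k l) ^ 2 ≤ 4 * R := by
    calc _ = ∑ l, ((B - Bstar) k l + -(B - Bstar) j l) ^ 2 := by
          simp only [Matrix.sub_apply, h]
          congr! 2
          ring
      _ ≤ ∑ l, 2 * ((B - Bstar) k l ^ 2 + (B - Bstar) j l ^ 2) := by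
          gcongr with l
          exact add_sq_le.trans_eq (by rw [neg_sq])
      _ = 2 * (∑ l, (B - Bstar) k l ^ 2 + ∑ l, (B - Bstar) j l ^ 2) := by
          rw [← Finset.mul_sum, Finset.sum_add_distrib]
      _ ≤ 4 * R := by linarith [hrow j, hrow k]
  exact (hsep j k hne).not_ge hle

lemma eq_of_eq_of_ncard_range_le {ι α β : Type*} [Finite ι] {f : ι → α} {g : ι → β}
    (hfg : ∀ j k, f j = f k → g j = g k) (hcard : (Set.range f).ncard ≤ (Set.range g).ncard)
    {j k : ι} (h : g j = g k) : f j = f k := by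
  have : Nonempty β := ⟨g j⟩
  obtain ⟨e, rfl⟩ := (Function.factorsThrough_iff g).1 fun j k => hfg j k
  have hinj : Set.InjOn e (Set.range f) := Set.injOn_of_ncard_image_eq
    ((Set.ncard_image_le).antisymm (hcard.trans_eq (by rw [Set.range_comp])))
  exact hinj (Set.mem_range_self j) (Set.mem_range_self k) h

end Rows

section OracleInequality

variable {n p m q r : ℕ} {X : Matrix (Fin n) (Fin p) ℝ} {Bstar : Matrix (Fin p) (Fin m) ℝ}
  {Ω : Type*} [MeasurableSpace Ω] {P : Measure Ω} {E : Ω → Matrix (Fin n) (Fin m) ℝ}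
  {f : Ω → Matrix (Fin n) (Fin m) ℝ → ℝ} {μ σ : ℝ} {Bhat : Ω → Matrix (Fin p) (Fin m) ℝ}

lemma psi2Norm_frobInner_le (hσ : 0 ≤ σ) {A : Matrix (Fin n) (Fin m) ℝ}
    (hE : psi2Norm P (fun ω => frobInner (E ω) A) ≤ ENNReal.ofReal (σ * √(frobSq A)))
    (hA : frobSq A ≤ 1) : psi2Norm P (fun ω => frobInner (E ω) A) ≤ ENNReal.ofReal σ :=
  hE.trans (ENNReal.ofReal_le_ofReal (mul_le_of_le_one_right hσ (Real.sqrt_le_one.2 hA)))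

lemma aemeasurable_frobInner (hE : ∀ i j, AEMeasurable (fun ω => E ω i j) P)
    (A : Matrix (Fin n) (Fin m) ℝ) : AEMeasurable (fun ω => frobInner (E ω) A) P :=
  Finset.aemeasurable_fun_sum _ fun i _ =>
    Finset.aemeasurable_fun_sum _ fun j _ => (hE i j).mul_const _

variable [IsProbabilityMeasure P]

lemma lintegral_iSup_frobInner_sq_le (hσ : 0 ≤ σ) (hEm : ∀ i j, AEMeasurable (fun ω => E ω i j) P)
    (hE : ∀ A, psi2Norm P (fun ω => frobInner (E ω) A) ≤ ENNReal.ofReal (σ * √(frobSq A)))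
    {s : Finset (Matrix (Fin n) (Fin m) ℝ)} (hs : ∀ A ∈ s, frobSq A ≤ 1) {K : ℝ} (hK : 0 ≤ K)
    (hcard : (s.card : ℝ) ≤ Real.exp K) :
    ∫⁻ ω, ⨆ A ∈ s, ENNReal.ofReal (frobInner (E ω) A ^ 2) ∂P ≤ ENNReal.ofReal (σ ^ 2 * (K + 2)) :=
  lintegral_iSup_sq_le (fun A _ => aemeasurable_frobInner hEm A) hσ
    (fun A hA => psi2Norm_frobInner_le hσ (hE A) (hs A hA)) hK hcard

theorem lintegral_bregman_le (hμ : 0 < μ) (hσ : 0 ≤ σ) (hq : 1 ≤ q) (hqp : q ≤ p)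
    (hf : ∀ ω, StronglyConvex μ (f ω))
    (hEm : ∀ i j, AEMeasurable (fun ω => (-grad (f ω) (X * Bstar)) i j) P)
    (hE : ∀ A, psi2Norm P (fun ω => frobInner (-grad (f ω) (X * Bstar)) A) ≤
      ENNReal.ofReal (σ * √(frobSq A)))
    (hBhat : ∀ᵐ ω ∂P, IsGlobalCRL X (f ω) q r (Bhat ω)) {B : Matrix (Fin p) (Fin m) ℝ}
    (hB : B ∈ feasible p m q r) :
    ∫⁻ ω, ENNReal.ofReal (bregman (f ω) (X * Bhat ω) (X * Bstar)) ∂P ≤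
      ENNReal.ofReal 512 *
        (∫⁻ ω, ENNReal.ofReal (bregman (f ω) (X * B) (X * Bstar)) ∂P +
          ENNReal.ofReal (σ ^ 2 / μ * (complexity m X q r + 1))) := by
  have hκ : 0 ≤ complexity m X q r := complexity_nonneg hqp
  obtain ⟨s, hcard, hs, hnet⟩ := exists_feasible_net X hq hqp hB
  set I := ∫⁻ ω, ENNReal.ofReal (bregman (f ω) (X * B) (X * Bstar)) ∂P
  let G (ω : Ω) : ℝ≥0∞ := ⨆ A ∈ s, ENNReal.ofReal (frobInner (-grad (f ω) (X * Bstar)) A ^ 2)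
  have hG : AEMeasurable G P := AEMeasurable.biSup _ s.countable_toSet fun A _ =>
    ((aemeasurable_frobInner hEm A).pow_const 2).ennreal_ofReal
  have hpt : ∀ᵐ ω ∂P, ENNReal.ofReal (bregman (f ω) (X * Bhat ω) (X * Bstar)) ≤
      ENNReal.ofReal 3 * ENNReal.ofReal (bregman (f ω) (X * B) (X * Bstar)) +
        ENNReal.ofReal (64 / μ) * G ω := by
    filter_upwards [hBhat] with ω hω
    obtain ⟨A, hA, hle⟩ := hnet _ hω.1 (-grad (f ω) (X * Bstar))
    refine (ENNReal.ofReal_le_ofReal (hω.bregman_le_of_frobInner_le (hf ω) hμ hB hle)).trans ?_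
    rw [ENNReal.ofReal_add (mul_nonneg zero_le_three ((hf ω).bregman_nonneg hμ.le _ _))
      (by positivity), ENNReal.ofReal_mul zero_le_three,
      ENNReal.ofReal_mul (p := 64 / μ) (by positivity)]
    gcongr
    exact le_iSup₂_of_le A hA le_rfl
  calc _ ≤ ENNReal.ofReal 3 * I + ENNReal.ofReal (64 / μ) * ∫⁻ ω, G ω ∂P := by
        refine (lintegral_mono_ae hpt).trans_eq ?_
        rw [lintegral_add_right' _ (hG.const_mul _),
          lintegral_const_mul' _ _ ENNReal.ofReal_ne_top, lintegral_const_mul'' _ hG]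
    _ ≤ ENNReal.ofReal 3 * I +
        ENNReal.ofReal (64 / μ * (σ ^ 2 * (8 * complexity m X q r + 2))) := by
        rw [ENNReal.ofReal_mul (p := 64 / μ) (by positivity)]
        gcongr
        exact lintegral_iSup_frobInner_sq_le hσ hEm hE hs (by positivity) hcard
    _ ≤ ENNReal.ofReal 512 * I +
        ENNReal.ofReal (512 * (σ ^ 2 / μ * (complexity m X q r + 1))) := by
        gcongr ENNReal.ofReal ?_ * I + ENNReal.ofReal ?_
        · norm_num
        · calc _ = σ ^ 2 / μ * (512 * complexity m X q r + 128) := by ring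
            _ ≤ σ ^ 2 / μ * (512 * complexity m X q r + 512) := by gcongr; norm_num
            _ = _ := by ring
    _ = _ := by rw [mul_add (ENNReal.ofReal 512), ENNReal.ofReal_mul (by norm_num)]

end OracleInequality

section Recovery

variable {n p m q r : ℕ} {X : Matrix (Fin n) (Fin p) ℝ} {Bstar : Matrix (Fin p) (Fin m) ℝ}
  {μ σ ϑ δ : ℝ}

/-- The restricted eigenvalue condition with constant `δ`: the design `X` is bounded below on the
matrices that a difference of `Bstar` and a feasible matrix of `ϑ` times its size can be. The
left-hand side carries the row-wise norm, the right-hand side the Frobenius norm divided by `n`. -/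
def RestrictedEigenvalue (X : Matrix (Fin n) (Fin p) ℝ) (Bstar : Matrix (Fin p) (Fin m) ℝ)
    (ϑ δ : ℝ) : Prop :=
  ∀ B : Matrix (Fin p) (Fin m) ℝ, (B.rank : ℝ) ≤ (1 + ϑ) * Bstar.rank →
    (numRows B : ℝ) ≤ ϑ * (numRows Bstar : ℝ) ^ 2 → δ * twoInfNorm B ^ 2 ≤ frobSq (X * B) / n

lemma mem_feasible_of_eq_mul (hϑ : 1 ≤ ϑ) (hr : (r : ℝ) = ϑ * Bstar.rank)
    (hq : (q : ℝ) = ϑ * numRows Bstar) : Bstar ∈ feasible p m q r := by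
  constructor
  · exact Nat.cast_le.1 ((le_mul_of_one_le_left (Nat.cast_nonneg _) hϑ).trans_eq hr.symm)
  · exact Nat.cast_le.1 ((le_mul_of_one_le_left (Nat.cast_nonneg _) hϑ).trans_eq hq.symm)

lemma twoInfNorm_sub_sq_le_of_feasible (hδ : 0 < δ) (hr : (r : ℝ) = ϑ * Bstar.rank)
    (hq : (q : ℝ) = ϑ * numRows Bstar)
    (hX : RestrictedEigenvalue X Bstar ϑ δ)
    {B : Matrix (Fin p) (Fin m) ℝ} (hB : B ∈ feasible p m q r) :
    twoInfNorm (B - Bstar) ^ 2 ≤ frobSq (X * (B - Bstar)) / (n * δ) := by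
  have hrank : ((B - Bstar).rank : ℝ) ≤ r + Bstar.rank := by
    exact_mod_cast (rank_sub_le B Bstar).trans (Nat.add_le_add_right hB.1 _)
  have hrows : (numRows (B - Bstar) : ℝ) ≤ q * numRows Bstar := by
    exact_mod_cast (numRows_sub_le B Bstar).trans (Nat.mul_le_mul_right _ hB.2)
  rw [← div_div, le_div_iff₀' hδ]
  exact hX _ (by linarith) (by rwa [sq, ← mul_assoc, ← hq])

lemma IsGlobalCRL.twoInfNorm_sub_sq_le_estBound {f : Matrix (Fin n) (Fin m) ℝ → ℝ}
    {Bhat : Matrix (Fin p) (Fin m) ℝ} (hBhat : IsGlobalCRL X f q r Bhat)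
    (hf : StronglyConvex μ f) (hμ : 0 < μ) (hϑ : 1 ≤ ϑ) (hδ : 0 < δ)
    (hr : (r : ℝ) = ϑ * Bstar.rank) (hq : (q : ℝ) = ϑ * numRows Bstar)
    (hX : RestrictedEigenvalue X Bstar ϑ δ)
    {z : ℝ} (hz : frobInner (-grad f (X * Bstar)) (X * Bhat - X * Bstar) ≤
      4 * √(frobSq (X * Bhat - X * Bstar)) * z)
    (hzσ : z ^ 2 ≤ σ ^ 2 * (9 * (ϑ ^ 2 * complexity m X (numRows Bstar) Bstar.rank))) :
    twoInfNorm (Bhat - Bstar) ^ 2 ≤ estBound X Bstar 1152 ϑ σ δ μ := by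
  have hfrob := hBhat.frobSq_le_of_frobInner_le hf hμ (mem_feasible_of_eq_mul hϑ hr hq) hz
  calc _ ≤ frobSq (X * (Bhat - Bstar)) / (n * δ) :=
        twoInfNorm_sub_sq_le_of_feasible hδ hr hq hX hBhat.1
    _ ≤ 128 / μ ^ 2 * (σ ^ 2 * (9 * (ϑ ^ 2 * complexity m X (numRows Bstar) Bstar.rank))) /
        (n * δ) := by
        gcongr
        exact hfrob.trans (by gcongr)
    _ = _ := by
        rw [estBound]
        ring

variable {Ω : Type*} [MeasurableSpace Ω] {P : Measure Ω} {f : Ω → Matrix (Fin n) (Fin m) ℝ → ℝ}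
  {Bhat : Ω → Matrix (Fin p) (Fin m) ℝ}

theorem measure_compl_twoInfNorm_sub_sq_le_estBound_le (hμ : 0 < μ) (hσ : 0 ≤ σ) (hq : 1 ≤ q)
    (hqp : q ≤ p) (hf : ∀ ω, StronglyConvex μ (f ω))
    (hEm : ∀ i j, AEMeasurable (fun ω => (-grad (f ω) (X * Bstar)) i j) P)
    (hE : ∀ A, psi2Norm P (fun ω => frobInner (-grad (f ω) (X * Bstar)) A) ≤
      ENNReal.ofReal (σ * √(frobSq A)))
    (hBhat : ∀ᵐ ω ∂P, IsGlobalCRL X (f ω) q r (Bhat ω)) (hϑ : 1 ≤ ϑ) (hδ : 0 < δ)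
    (hrows : 1 < numRows Bstar) (hr : (r : ℝ) = ϑ * Bstar.rank)
    (hq' : (q : ℝ) = ϑ * numRows Bstar) (hX : RestrictedEigenvalue X Bstar ϑ δ) :
    P {ω | twoInfNorm (Bhat ω - Bstar) ^ 2 ≤ estBound X Bstar 1152 ϑ σ δ μ}ᶜ ≤
      ENNReal.ofReal (2 * Real.exp (-(1 / 2) * (m + X.rank))) := by
  obtain ⟨s, hcard, hs, hnet⟩ :=
    exists_feasible_net X hq hqp (mem_feasible_of_eq_mul hϑ hr hq')
  have hκϑ := complexity_le_sq_mul (m := m) (X := X) hϑ hrows hqp hr hq'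
  have hκrank := half_mul_add_rank_le_complexity (m := m) (X := X) hrows (numRows_le Bstar)
    (rank_pos_of_one_lt_numRows hrows)
  have hκ0 : 0 ≤ complexity m X (numRows Bstar) Bstar.rank := complexity_nonneg (numRows_le Bstar)
  set κ := complexity m X (numRows Bstar) Bstar.rank
  let Z (A : Matrix (Fin n) (Fin m) ℝ) (ω : Ω) : ℝ := frobInner (-grad (f ω) (X * Bstar)) A
  have hsub : ∀ᵐ ω ∂P, ¬ twoInfNorm (Bhat ω - Bstar) ^ 2 ≤ estBound X Bstar 1152 ϑ σ δ μ →
      ∃ A ∈ s, σ ^ 2 * (9 * (ϑ ^ 2 * κ)) < Z A ω ^ 2 := by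
    filter_upwards [hBhat] with ω hω hfar
    by_contra hsmall
    obtain ⟨A, hA, hle⟩ := hnet _ hω.1 (-grad (f ω) (X * Bstar))
    have hZ : Z A ω ^ 2 ≤ σ ^ 2 * (9 * (ϑ ^ 2 * κ)) := not_lt.1 fun hlt => hsmall ⟨A, hA, hlt⟩
    exact hfar (hω.twoInfNorm_sub_sq_le_estBound (hf ω) hμ hϑ hδ hr hq' hX hle hZ)
  calc _ ≤ ENNReal.ofReal (s.card * (2 * Real.exp (-(9 * (ϑ ^ 2 * κ))))) :=
        (measure_mono_ae hsub).trans <|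
          measure_exists_sq_gt_le (fun A _ => aemeasurable_frobInner hEm A) hσ
            (fun A hA => psi2Norm_frobInner_le hσ (hE A) (hs A hA)) (by positivity)
    _ ≤ ENNReal.ofReal (2 * Real.exp (-(1 / 2) * (m + X.rank))) := by
        refine ENNReal.ofReal_le_ofReal ?_
        calc _ ≤ Real.exp (8 * (ϑ ^ 2 * κ)) * (2 * Real.exp (-(9 * (ϑ ^ 2 * κ)))) := by
              gcongr
              exact hcard.trans (by gcongr)
          _ = 2 * Real.exp (-(ϑ ^ 2 * κ)) := by
              rw [mul_left_comm, ← Real.exp_add]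
              ring_nf
          _ ≤ _ := by
              have hκ : κ ≤ ϑ ^ 2 * κ := le_mul_of_one_le_left hκ0 (one_le_pow₀ hϑ)
              gcongr
              linarith

lemma row_eq_iff_of_twoInfNorm_sub_sq_le {B : Matrix (Fin p) (Fin m) ℝ} {R : ℝ}
    (hB : numRows B ≤ q) (hR : twoInfNorm (B - Bstar) ^ 2 ≤ R)
    (hsep : ∀ j k, Bstar j ≠ Bstar k → 4 * R < ∑ l, (Bstar j l - Bstar k l) ^ 2) :
    (∀ j k, B j = B k → Bstar j = Bstar k) ∧
      (q = numRows Bstar → ∀ j k, B j = B k ↔ Bstar j = Bstar k) := by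
  have hrefine : ∀ j k, B j = B k → Bstar j = Bstar k := fun _ _ => row_eq_of_row_eq hR hsep
  exact ⟨hrefine, fun hq j k =>
    ⟨hrefine j k, eq_of_eq_of_ncard_range_le hrefine (hB.trans_eq hq)⟩⟩

lemma one_sub_le_measureReal [IsProbabilityMeasure P] {S : Set Ω} {x : ℝ} (hx : 0 ≤ x)
    (hS : P Sᶜ ≤ ENNReal.ofReal x) : 1 - x ≤ P.real S := by
  have hone : (1 : ℝ≥0∞) ≤ ENNReal.ofReal (P.real S + x) := by
    rw [ENNReal.ofReal_add measureReal_nonneg hx, ofReal_measureReal, ← measure_univ (μ := P)]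
    exact (measure_univ_le_add_compl S).trans (by gcongr)
  exact sub_le_iff_le_add.2 (ENNReal.one_le_ofReal.1 hone)

end Recovery

end CRL

theorem corollary1_general {n p m : ℕ} (X : Matrix (Fin n) (Fin p) ℝ)
    (Bstar : Matrix (Fin p) (Fin m) ℝ) {Ω : Type*} [MeasurableSpace Ω] {P : Measure Ω}
    [IsProbabilityMeasure P] {f : Ω → Matrix (Fin n) (Fin m) ℝ → ℝ} {μ σ : ℝ} {q r : ℕ}
    {Bhat : Ω → Matrix (Fin p) (Fin m) ℝ} (hμ : 0 < μ) (hσ : 0 ≤ σ) (hq : 1 ≤ q) (hqp : q ≤ p)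
    (hf : ∀ ω, StronglyConvex μ (f ω))
    (hEm : ∀ i j, AEMeasurable (fun ω => (-grad (f ω) (X * Bstar)) i j) P)
    (hE : ∀ A, psi2Norm P (fun ω => frobInner (-grad (f ω) (X * Bstar)) A) ≤
      ENNReal.ofReal (σ * √(frobSq A)))
    (hBhat : ∀ᵐ ω ∂P, IsGlobalCRL X (f ω) q r (Bhat ω)) :
    (∀ B ∈ feasible p m q r,
      ∫⁻ ω, ENNReal.ofReal (bregman (f ω) (X * Bhat ω) (X * Bstar)) ∂P ≤
        ENNReal.ofReal 512 *
          (∫⁻ ω, ENNReal.ofReal (bregman (f ω) (X * B) (X * Bstar)) ∂P +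
            ENNReal.ofReal (σ ^ 2 / μ * (complexity m X q r + 1)))) ∧
    (∀ ϑ δ : ℝ, 1 ≤ ϑ → 0 < δ → 1 < numRows Bstar →
      (r : ℝ) = ϑ * Bstar.rank → (q : ℝ) = ϑ * numRows Bstar →
      RestrictedEigenvalue X Bstar ϑ δ →
      1 - 2 * Real.exp (-(1 / 2) * (m + X.rank)) ≤
          P.real {ω | twoInfNorm (Bhat ω - Bstar) ^ 2 ≤ estBound X Bstar 1152 ϑ σ δ μ} ∧
      ((∀ j k, Bstar j ≠ Bstar k →
          4 * estBound X Bstar 1152 ϑ σ δ μ < ∑ l, (Bstar j l - Bstar k l) ^ 2) →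
        1 - 2 * Real.exp (-(1 / 2) * (m + X.rank)) ≤
          P.real {ω | (∀ j k, Bhat ω j = Bhat ω k → Bstar j = Bstar k) ∧
            (q = numRows Bstar → ∀ j k, Bhat ω j = Bhat ω k ↔ Bstar j = Bstar k)})) := by
  refine ⟨fun B hB => lintegral_bregman_le hμ hσ hq hqp hf hEm hE hBhat hB,
    fun ϑ δ hϑ hδ hrows hr hq' hX => ?_⟩
  have htail := measure_compl_twoInfNorm_sub_sq_le_estBound_le hμ hσ hq hqp hf hEm hE hBhat hϑ hδ
    hrows hr hq' hX
  refine ⟨one_sub_le_measureReal (by positivity) htail,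
    fun hsep => one_sub_le_measureReal (by positivity) (htail.trans' (measure_mono_ae ?_))⟩
  filter_upwards [hBhat] with ω hω hmiss hclose
  exact hmiss (row_eq_iff_of_twoInfNorm_sub_sq_le hω.1.2 hclose hsep)

theorem corollary1 :
    ∃ C₁ c₀ c C : ℝ, 0 < C₁ ∧ 0 < c₀ ∧ 0 < c ∧ 0 < C ∧
    ∀ (n p m : ℕ) (X : Matrix (Fin n) (Fin p) ℝ) (Bstar : Matrix (Fin p) (Fin m) ℝ)
      (Ω : Type u) [MeasurableSpace Ω] (P : Measure Ω) [IsProbabilityMeasure P]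
      (𝒴 : Type v) [MeasurableSpace 𝒴] (Y : Ω → 𝒴) (l₀ : Matrix (Fin n) (Fin m) ℝ → 𝒴 → ℝ)
      (μ σ : ℝ) (q r : ℕ) (Bhat : Ω → Matrix (Fin p) (Fin m) ℝ),
      Measurable Y → (∀ η, Measurable (l₀ η)) → (∀ j l, Measurable fun ω => Bhat ω j l) →
      0 < μ → 0 ≤ σ → 1 ≤ q → q ≤ p →
      (∀ y, StronglyConvex μ fun η => l₀ η y) →
      SubGaussianMatrix P (fun ω => -grad (fun η => l₀ η (Y ω)) (X * Bstar)) σ →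
      (∀ᵐ ω ∂P, IsGlobalCRL X (fun η => l₀ η (Y ω)) q r (Bhat ω)) →
      -- oracle inequality
      (∀ B ∈ feasible p m q r,
        ∫⁻ ω, ENNReal.ofReal (bregman (fun η => l₀ η (Y ω)) (X * Bhat ω) (X * Bstar)) ∂P ≤
          ENNReal.ofReal C₁ *
            (∫⁻ ω, ENNReal.ofReal (bregman (fun η => l₀ η (Y ω)) (X * B) (X * Bstar)) ∂P +
              ENNReal.ofReal (σ ^ 2 / μ * (complexity m X q r + 1)))) ∧
      -- estimation error and cluster recovery
      (∀ ϑ δ : ℝ, 1 ≤ ϑ → 0 < δ → 1 < numRows Bstar →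
        (r : ℝ) = ϑ * Bstar.rank → (q : ℝ) = ϑ * numRows Bstar →
        (∀ B : Matrix (Fin p) (Fin m) ℝ, (B.rank : ℝ) ≤ (1 + ϑ) * Bstar.rank →
          (numRows B : ℝ) ≤ ϑ * (numRows Bstar : ℝ) ^ 2 →
          δ * twoInfNorm B ^ 2 ≤ frobSq (X * B) / n) →
        1 - C * Real.exp (-c * (m + X.rank)) ≤
            P.real {ω | twoInfNorm (Bhat ω - Bstar) ^ 2 ≤ estBound X Bstar c₀ ϑ σ δ μ} ∧
        ((∀ j k, Bstar j ≠ Bstar k →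
            4 * estBound X Bstar c₀ ϑ σ δ μ < ∑ l, (Bstar j l - Bstar k l) ^ 2) →
          1 - C * Real.exp (-c * (m + X.rank)) ≤
            P.real {ω | (∀ j k, Bhat ω j = Bhat ω k → Bstar j = Bstar k) ∧
              (q = numRows Bstar → ∀ j k, Bhat ω j = Bhat ω k ↔ Bstar j = Bstar k)})) :=
  ⟨512, 1152, 1 / 2, 2, by norm_num, by norm_num, by norm_num, by norm_num,
    fun _ _ _ X Bstar _ _ _ _ _ _ Y _ _ _ _ _ _ _ _ _ hμ hσ hq hqp hconv hE hBhat =>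
      corollary1_general X Bstar hμ hσ hq hqp (fun ω => hconv (Y ω)) hE.1 hE.2.2 hBhat⟩
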